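/- Call an operation $\mathrm{mi}\colon\mathbb{Q}^2\to\mathbb{Q}$ an operation of type mi if there are endomorphisms $\alpha,\beta,\gamma$ of $(\mathbb{Q};<)$ with $\alpha(a)<\beta(a)<\gamma(a)<\alpha(a+\varepsilon)$ for all $a,\varepsilon\in\mathbb{Q}$ with $\varepsilon>0$, such that $\mathrm{mi}(x,y)=\alpha(x)$ if $x=y$, $\mathrm{mi}(x,y)=\beta(y)$ if $x>y$, and $\mathrm{mi}(x,y)=\gamma(x)$ if $x<y$. Call an operation $\mathrm{ll}\colon\mathbb{Q}^2\to\mathbb{Q}$ an operation of type ll if $\mathrm{ll}(a,b)<\mathrm{ll}(a',b')$ holds if and only if one of the following holds: (i) $a\le 0$ and $a<a'$; (ii) $a\le 0$, $a=a'$ and $b<b'$; (iii) $a,a'>0$ and $b<b'$; (iv) $a>0$, $b=b'$ and $a<a'$. Let $$R^{\mathrm{mix}}=\{(a_1,a_2,a_3)\in\mathbb{Q}^3 \mid a_1=a_2 \text{ or } (a_3<a_1 \text{ and } a_3<a_2)\}.$$ A first-order expansion of $(\mathbb{Q};<)$ is a relational structure $\mathfrak{A}$ with domain $\mathbb{Q}$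 (its signature may be infinite) such that $<$ is one of its relations and each of its relations is first-order definable (without parameters) in $(\mathbb{Q};<)$. A structure is preserved by a binary operation $f$ if, for each of its relations $R$ and all tuples $s,t\in R$, the tuple obtained by applying $f$ componentwise to $s$ and $t$ is in $R$. A relation is primitively positively definable in $\mathfrak{A}$ if it is defined in $\mathfrak{A}$ by a formula $\exists y_1\cdots\exists y_m\,\phi$ with $m\ge 0$, where $\phi$ is a conjunction of atomic formulas (equalities of variables, relation symbols of $\mathfrak{A}$ applied to variables, or the formula "false"). Proposition. Let $\mathrm{mi}$ be any operation of type mi and let $\mathrm{ll}$ be any operation of type ll. Let $\mathfrak{A}$ be a first-order expansion of $(\mathbb{Q};<)$ that is preserved by $\mathrm{mi}$ but not by $\mathrm{ll}$. Then $R^{\mathrm{mix}}$ is primitively positively definable in $\mathfrak{A}$. -/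

import Mathlib

namespace TemporalCSP

open FirstOrder FirstOrder.Language

universe u v w u'

/-! ### Primitive positive definability -/

section PrimitivePositive

variable {L : FirstOrder.Language.{u, v}} {α : Type u'}

/-- Nonempty finite conjunctions of atomic formulas. As in the source, the logical "false" counts
as an atomic formula, besides equalities and relation symbols applied to variables (in a relational
language every term is a variable). -/
inductive IsConjOfAtoms : {n : ℕ} → L.BoundedFormula α n → Prop
  | falsum {n : ℕ} : IsConjOfAtoms (BoundedFormula.falsum : L.BoundedFormula α n)
  | atomic {n : ℕ} {φ : L.BoundedFormula α n} (h : φ.IsAtomic) : IsConjOfAtoms φ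
  | inf {n : ℕ} {φ ψ : L.BoundedFormula α n} (h₁ : IsConjOfAtoms φ) (h₂ : IsConjOfAtoms ψ) :
      IsConjOfAtoms (φ ⊓ ψ)

/-- Primitive positive formulas: a block of existential quantifiers (possibly empty) in front of
a conjunction of atomic formulas. -/
inductive IsPrimitivePositive : {n : ℕ} → L.BoundedFormula α n → Prop
  | of_conj {n : ℕ} {φ : L.BoundedFormula α n} (h : IsConjOfAtoms φ) : IsPrimitivePositive φ
  | ex {n : ℕ} {φ : L.BoundedFormula α (n + 1)} (h : IsPrimitivePositive φ) :
      IsPrimitivePositive φ.ex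

end PrimitivePositive

/-- A `k`-ary relation `R` on `M` is primitively positively definable in the `L`-structure `M`
(without parameters). -/
def PPDefinable (L : FirstOrder.Language.{u, v}) {M : Type w} [L.Structure M] {k : ℕ}
    (R : Set (Fin k → M)) : Prop :=
  ∃ φ : L.Formula (Fin k), IsPrimitivePositive φ ∧ R = {a | φ.Realize a}

/-! ### Polymorphisms -/

/-- The binary operation `f` preserves the relation `R`: applying `f` componentwise to two tuples
of `R` yields a tuple of `R`. -/
def Preserves {M : Type w} (f : M → M → M) {n : ℕ} (R : Set (Fin n → M)) : Prop :=
  ∀ s ∈ R, ∀ t ∈ R, (fun i => f (s i) (t i)) ∈ R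

/-- The `L`-structure `M` is preserved by the binary operation `f`, that is, `f` preserves all
relations of the structure. -/
def IsPreservedBy (L : FirstOrder.Language.{u, v}) {M : Type w} [L.Structure M] (f : M → M → M) : Prop :=
  ∀ (n : ℕ) (r : L.Relations n), Preserves f {a : Fin n → M | Structure.RelMap r a}

/-! ### First-order expansions of `(ℚ; <)` -/

/-- The only symbol of the signature `{<}`, of arity two. -/
inductive LtRel : ℕ → Type
  | lt : LtRel 2

/-- The relational signature `{<}`. -/
def ltLanguage : FirstOrder.Language := ⟨fun _ => Empty, LtRel⟩

/-- The structure `(ℚ; <)`. -/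
instance ratLtStructure : ltLanguage.Structure ℚ where
  funMap := fun f => Empty.elim f
  RelMap := fun r => match r with
    | LtRel.lt => fun a => a 0 < a 1

/-- The `L`-structure on `ℚ` is a first-order expansion of `(ℚ; <)`: the order `<` is one of its
relations, and each of its relations is first-order definable (without parameters) in `(ℚ; <)`. -/
def IsFirstOrderExpansionOfRatLt (L : FirstOrder.Language.{u, v}) [L.Structure ℚ] : Prop :=
  (∃ r : L.Relations 2, ∀ a : Fin 2 → ℚ, Structure.RelMap r a ↔ a 0 < a 1) ∧
    ∀ (n : ℕ) (r : L.Relations n),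
      (∅ : Set ℚ).Definable ltLanguage {a : Fin n → ℚ | Structure.RelMap r a}

/-! ### The operations `mi` and `ll`, and the relation `R^mix` -/

/-- `f` is an operation `mi`, for some choice of endomorphisms `α`, `β`, `γ` of `(ℚ; <)`. -/
def IsMi (f : ℚ → ℚ → ℚ) : Prop :=
  ∃ α β γ : ℚ → ℚ, StrictMono α ∧ StrictMono β ∧ StrictMono γ ∧
    (∀ a ε : ℚ, 0 < ε → α a < β a ∧ β a < γ a ∧ γ a < α (a + ε)) ∧
    ∀ x y : ℚ, (x = y → f x y = α x) ∧ (y < x → f x y = β y) ∧ (x < y → f x y = γ x)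

/-- `f` is an operation `ll`. -/
def IsLl (f : ℚ → ℚ → ℚ) : Prop :=
  ∀ a b a' b' : ℚ, f a b < f a' b' ↔
    (a ≤ 0 ∧ a < a') ∨
    (a ≤ 0 ∧ a = a' ∧ b < b') ∨
    (0 < a ∧ 0 < a' ∧ b < b') ∨
    (0 < a ∧ b = b' ∧ a < a')

/-- The relation `R^mix`. -/
def Rmix : Set (Fin 3 → ℚ) :=
  {a | a 0 = a 1 ∨ (a 2 < a 0 ∧ a 2 < a 1)}

end TemporalCSP

namespace TemporalCSP

open FirstOrder FirstOrder.Language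

/-! ### Building primitive positive definitions -/

section PrimitivePositiveToolkit

variable {L : FirstOrder.Language} {M : Type*} [L.Structure M] {α γ : Type*}

/-! Take `s`, `t` in a relation `R` with `u = ll(s, t)` outside `R`. Closure under `mi` makes
membership local (`mem_of_local_tuples`), so at some `j` no tuple of `R` is constant on E, the
indices where `u` equals `u j`, and exceeds its `j`-th entry on U, the indices where `u` exceeds `u
j`. From `u j` upwards, `ll` compares pairs lexicographically, with `s` or `t` leading. From this
`mi` produces a nonempty K ⊆ U (`exists_forced_ties`): among tuples constant on E, K ties with `j`
whenever `j` is minimal on U, yet K can also rise above `j` with one common value.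

Read off x = entry at `j`, y = common entry on K, z = a strict lower bound on the rest of U. The
resulting ternary relation contains all triples with x = y or z < x < y, and in it x < y forces z <
x. Joining two copies of it defines `Rmix`. First-order definability enters only as invariance under
order type, which lets strictly increasing maps move tuples inside `R`. -/

theorem IsConjOfAtoms.relabel {m n : ℕ} {φ : L.BoundedFormula α m} (h : IsConjOfAtoms φ)
    (f : α → γ ⊕ Fin n) : IsConjOfAtoms (φ.relabel f) := by
  induction h with
  | falsum => exact .falsum
  | atomic h => exact .atomic (h.relabel f)
  | inf _ _ ih₁ ih₂ => exact .inf ih₁ ih₂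

theorem IsPrimitivePositive.exs {n : ℕ} {φ : L.BoundedFormula α n} (h : IsPrimitivePositive φ) :
    IsPrimitivePositive φ.exs := by
  induction n with
  | zero => exact h
  | succ n ih => exact ih h.ex

/-- The set `S` is defined by a finite conjunction of atomic formulas. -/
def ConjDefinable (L : FirstOrder.Language) {M : Type*} [L.Structure M] {γ : Type*}
    (S : Set (γ → M)) : Prop :=
  ∃ φ : L.Formula γ, IsConjOfAtoms φ ∧ ∀ v, φ.Realize v ↔ v ∈ S

theorem ConjDefinable.eq (i j : γ) : ConjDefinable L {v : γ → M | v i = v j} :=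
  ⟨Term.equal (Term.var i) (Term.var j), .atomic (.equal _ _), fun v => by
    simp [Formula.realize_equal]⟩

theorem ConjDefinable.rel {n : ℕ} (r : L.Relations n) (f : Fin n → γ) :
    ConjDefinable L {v : γ → M | Structure.RelMap r fun i => v (f i)} :=
  ⟨r.formula fun i => Term.var (f i), .atomic (.rel _ _), fun v => by
    simp [Formula.realize_rel]⟩

theorem ConjDefinable.and {p q : (γ → M) → Prop} (hp : ConjDefinable L {v | p v})
    (hq : ConjDefinable L {v | q v}) : ConjDefinable L {v | p v ∧ q v} := by
  obtain ⟨φ, hφ, hφp⟩ := hp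
  obtain ⟨ψ, hψ, hψq⟩ := hq
  exact ⟨φ ⊓ ψ, .inf hφ hψ, fun v => by
    simpa using and_congr (hφp v) (hψq v)⟩

theorem ConjDefinable.true [Nonempty γ] : ConjDefinable L {_v : γ → M | True} := by
  obtain ⟨i⟩ := ‹Nonempty γ›
  simpa using ConjDefinable.eq (L := L) (M := M) i i

theorem ConjDefinable.forall_mem [Nonempty γ] {ι : Type*} (s : Finset ι)
    {p : ι → (γ → M) → Prop} (h : ∀ i ∈ s, ConjDefinable L {v | p i v}) :
    ConjDefinable L {v | ∀ i ∈ s, p i v} := by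
  classical
  induction s using Finset.induction_on with
  | empty => simpa using ConjDefinable.true (L := L) (M := M) (γ := γ)
  | insert a s _ ih =>
    simpa only [Finset.forall_mem_insert] using (h a (Finset.mem_insert_self a s)).and
      (ih fun i hi => h i (Finset.mem_insert_of_mem hi))

theorem ConjDefinable.ppDefinable_exists {β : Type*} [Finite β] {k : ℕ}
    {S : Set ((Fin k ⊕ β) → M)} (hS : ConjDefinable L S) :
    PPDefinable L {a : Fin k → M | ∃ b : β → M, Sum.elim a b ∈ S} := by
  obtain ⟨φ, hφ, hφS⟩ := hS
  refine ⟨φ.iExs β, (IsPrimitivePositive.of_conj (hφ.relabel _)).exs, ?_⟩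
  ext a
  simp [Formula.realize_iExs, hφS]

end PrimitivePositiveToolkit

/-! ### Invariance of definable relations under order type -/

/-- Membership in `R` depends only on the order type of a tuple. -/
def OrderInvariant {n : ℕ} (R : Set (Fin n → ℚ)) : Prop :=
  ∀ a ∈ R, ∀ b : Fin n → ℚ, (∀ i j, a i < a j ↔ b i < b j) → b ∈ R

theorem OrderInvariant.comp_strictMono {n : ℕ} {R : Set (Fin n → ℚ)} (hR : OrderInvariant R)
    {a : Fin n → ℚ} (ha : a ∈ R) {f : ℚ → ℚ} (hf : StrictMono f) : (fun i => f (a i)) ∈ R :=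
  hR a ha _ fun _ _ => hf.lt_iff_lt.symm

/-- The extension step of the back-and-forth argument: ℚ is dense without endpoints. -/
theorem exists_same_cut {α : Type*} [Finite α] {v w : α → ℚ} (h : ∀ i j, v i < v j ↔ w i < w j)
    (x : ℚ) : ∃ y, ∀ i, (v i < x ↔ w i < y) ∧ (x < v i ↔ y < w i) := by
  classical
  have := Fintype.ofFinite α
  by_cases hx : ∃ i, v i = x
  · obtain ⟨i, rfl⟩ := hx
    exact ⟨w i, fun j => ⟨h j i, h i j⟩⟩
  · push Not at hx
    obtain ⟨y, hlo, hhi⟩ := Order.exists_between_finsets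
      ((Finset.univ.filter fun i => v i < x).image w)
      ((Finset.univ.filter fun i => x < v i).image w) (by
        intro p hp q hq
        simp only [Finset.mem_image, Finset.mem_filter, Finset.mem_univ, true_and] at hp hq
        obtain ⟨i, hi, rfl⟩ := hp
        obtain ⟨j, hj, rfl⟩ := hq
        exact (h i j).1 (hi.trans hj))
    refine ⟨y, fun i => ?_⟩
    rcases lt_or_gt_of_ne (hx i) with hi | hi
    · have := hlo (w i) (Finset.mem_image_of_mem _ (by simpa using hi))
      exact ⟨iff_of_true hi this, iff_of_false hi.not_gt this.not_gt⟩
    · have := hhi (w i) (Finset.mem_image_of_mem _ (by simpa using hi))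
      exact ⟨iff_of_false hi.not_gt this.not_gt, iff_of_true hi this⟩

theorem same_order_type_snoc {α : Type*} {n : ℕ} {v w : α → ℚ} {xs ys : Fin n → ℚ} {x y : ℚ}
    (h : ∀ i j, Sum.elim v xs i < Sum.elim v xs j ↔ Sum.elim w ys i < Sum.elim w ys j)
    (hx : ∀ i, (Sum.elim v xs i < x ↔ Sum.elim w ys i < y) ∧
      (x < Sum.elim v xs i ↔ y < Sum.elim w ys i)) (i j : α ⊕ Fin (n + 1)) :
    Sum.elim v (Fin.snoc (α := fun _ => ℚ) xs x) i <
        Sum.elim v (Fin.snoc (α := fun _ => ℚ) xs x) j ↔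
      Sum.elim w (Fin.snoc (α := fun _ => ℚ) ys y) i <
        Sum.elim w (Fin.snoc (α := fun _ => ℚ) ys y) j := by
  have hc : ∀ i, (∃ i', Sum.elim v (Fin.snoc (α := fun _ => ℚ) xs x) i = Sum.elim v xs i' ∧
      Sum.elim w (Fin.snoc (α := fun _ => ℚ) ys y) i = Sum.elim w ys i') ∨
      (Sum.elim v (Fin.snoc (α := fun _ => ℚ) xs x) i = x ∧
      Sum.elim w (Fin.snoc (α := fun _ => ℚ) ys y) i = y) := by
    rintro (i | i)
    · exact .inl ⟨.inl i, rfl, rfl⟩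
    · refine Fin.lastCases ?_ (fun i => ?_) i
      · right; simp
      · left; exact ⟨.inr i, by simp⟩
  rcases hc i with ⟨i', h₁, h₂⟩ | ⟨h₁, h₂⟩ <;> rcases hc j with ⟨j', h₃, h₄⟩ | ⟨h₃, h₄⟩ <;>
    rw [h₁, h₂, h₃, h₄]
  · exact h i' j'
  · exact (hx i').1
  · exact (hx j').2
  · simp

theorem realize_congr_of_order_type {α : Type*} [Finite α] {n : ℕ}
    (φ : ltLanguage.BoundedFormula α n) {v w : α → ℚ} {xs ys : Fin n → ℚ}
    (h : ∀ i j, Sum.elim v xs i < Sum.elim v xs j ↔ Sum.elim w ys i < Sum.elim w ys j) :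
    φ.Realize v xs ↔ φ.Realize w ys := by
  induction φ with
  | falsum => exact Iff.rfl
  | equal t₁ t₂ =>
    rcases t₁ with i | ⟨f, _⟩
    · rcases t₂ with j | ⟨f, _⟩
      · have h₁ := h i j
        have h₂ := h j i
        change Sum.elim v xs i = Sum.elim v xs j ↔ Sum.elim w ys i = Sum.elim w ys j
        rw [le_antisymm_iff, le_antisymm_iff, ← not_lt, ← not_lt, ← not_lt, ← not_lt, h₁, h₂]
      · exact Empty.elim f
    · exact Empty.elim f
  | rel r ts =>
    cases r
    have hvar : ∀ k, ∃ i, ts k = Term.var i := by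
      intro k
      rcases ts k with i | ⟨f, _⟩
      · exact ⟨i, rfl⟩
      · exact Empty.elim f
    obtain ⟨i, hi⟩ := hvar 0
    obtain ⟨j, hj⟩ := hvar 1
    change (ts 0).realize (Sum.elim v xs) < (ts 1).realize (Sum.elim v xs) ↔
      (ts 0).realize (Sum.elim w ys) < (ts 1).realize (Sum.elim w ys)
    rw [hi, hj]
    exact h i j
  | imp _ _ ih₁ ih₂ => exact imp_congr (ih₁ h) (ih₂ h)
  | all φ ih =>
    simp only [BoundedFormula.realize_all]
    constructor
    · intro H y
      obtain ⟨x, hx⟩ := exists_same_cut (fun i j => (h i j).symm) y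
      exact (ih (same_order_type_snoc h fun i => ⟨(hx i).1.symm, (hx i).2.symm⟩)).1 (H x)
    · intro H x
      obtain ⟨y, hy⟩ := exists_same_cut h x
      exact (ih (same_order_type_snoc h hy)).2 (H y)

theorem OrderInvariant.of_definable {n : ℕ} {R : Set (Fin n → ℚ)}
    (hR : (∅ : Set ℚ).Definable ltLanguage R) : OrderInvariant R := by
  obtain ⟨φ, rfl⟩ := Set.empty_definable_iff.1 hR
  intro a ha b hab
  refine (realize_congr_of_order_type φ ?_).1 ha
  rintro (i | i) (j | j)
  · exact hab i j
  all_goals exact Fin.elim0 ‹_›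

/-! ### Relations preserved by `mi` -/

theorem IsMi.exists_params {f : ℚ → ℚ → ℚ} (hf : IsMi f) :
    ∃ α β γ : ℚ → ℚ, StrictMono α ∧ StrictMono β ∧ (∀ a, α a < β a) ∧ (∀ a, β a < γ a) ∧
      (∀ a b, a < b → γ a < α b) ∧ (∀ x, f x x = α x) ∧ (∀ x y, y < x → f x y = β y) ∧
      ∀ x y, x < y → f x y = γ x := by
  obtain ⟨α, β, γ, hα, hβ, -, h, hf⟩ := hf
  refine ⟨α, β, γ, hα, hβ, fun a => (h a 1 one_pos).1, fun a => (h a 1 one_pos).2.1,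
    fun a b hab => ?_, fun x => (hf x x).1 rfl, fun x y => (hf x y).2.1, fun x y => (hf x y).2.2⟩
  simpa using (h a (b - a) (sub_pos.2 hab)).2.2

/-- If for each coordinate `j` some tuple of `R` agrees with `u` on which coordinates at or above
`u j` are equal to, and which are strictly above the `j`-th one, then `u ∈ R`. -/
theorem mem_of_local_tuples {n : ℕ} {R : Set (Fin n → ℚ)} (hR : OrderInvariant R)
    {f : ℚ → ℚ → ℚ} (hf : IsMi f) (hpres : Preserves f R) (hne : R.Nonempty) {u : Fin n → ℚ}
    (hloc : ∀ j, ∃ a ∈ R, (∀ k, u k = u j → a k = a j) ∧ ∀ k, u j < u k → a j < a k) :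
    u ∈ R := by
  obtain ⟨α, β, γ, -, hβ, hαβ, -, hγα, -, hfgt, hflt⟩ := hf.exists_params
  -- Induction over sets closed upwards under `u`, adding one lowest level at a time.
  have main : ∀ s : Finset (Fin n), (∀ i k, i ∈ s → u i ≤ u k → k ∈ s) →
      ∃ b ∈ R, ∀ i ∈ s, ∀ k ∈ s, u i < u k ↔ b i < b k := by
    intro s
    induction s using Finset.strongInduction with
    | H s ih =>
      intro hs
      rcases s.eq_empty_or_nonempty with rfl | hsne
      · obtain ⟨b, hb⟩ := hne
        exact ⟨b, hb, by simp⟩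
      obtain ⟨j, hj, hjmin⟩ := s.exists_min_image u hsne
      obtain ⟨b, hb, hbu⟩ := ih (s.filter fun k => u j < u k)
        (Finset.filter_ssubset.2 ⟨j, hj, lt_irrefl _⟩) (by
          intro i k hi hik
          rw [Finset.mem_filter] at hi ⊢
          exact ⟨hs i k hi.1 hik, hi.2.trans_le hik⟩)
      obtain ⟨a, ha, haeq, halt⟩ := hloc j
      obtain ⟨N, hN⟩ : ∃ N : ℚ, ∀ i, |b i| < N := by
        obtain ⟨N, hN⟩ := (Set.finite_range fun i => |b i|).bddAbove
        exact ⟨N + 1, fun i => (hN ⟨i, rfl⟩).trans_lt (lt_add_one N)⟩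
      have hNpos : 0 < N := (abs_nonneg (b j)).trans_lt (hN j)
      -- With `a j` moved to 0 and `b` into (0, 2N), the jump by 2N puts the entries of `a` above `a
      -- j` beyond all of `b`. So `mi` is constantly `γ 0` on the lowest level and copies the order
      -- of `b` above it.
      have hmono : StrictMono fun q : ℚ => q - a j + if a j < q then 2 * N else 0 := by
        intro p q hpq
        dsimp only
        split_ifs <;> linarith
      refine ⟨_, hpres _ (hR.comp_strictMono ha hmono) _
        (hR.comp_strictMono hb (f := fun q => q + N) fun p q h => by simpa using h), ?_⟩
      have hlow : ∀ i, u i = u j → f (a i - a j + if a j < a i then 2 * N else 0) (b i + N) =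
          γ 0 := by
        intro i hi
        have := (abs_lt.1 (hN i)).1
        rw [haeq i hi, if_neg (lt_irrefl _), sub_self, add_zero]
        exact hflt _ _ (by linarith)
      have hhigh : ∀ i, u j < u i → f (a i - a j + if a j < a i then 2 * N else 0) (b i + N) =
          β (b i + N) := by
        intro i hi
        have := (abs_lt.1 (hN i)).2
        have h' := halt i hi
        rw [if_pos h']
        exact hfgt _ _ (by linarith)
      have hlt : ∀ i, γ 0 < β (b i + N) := fun i =>
        (hγα _ _ (by linarith [(abs_lt.1 (hN i)).1])).trans (hαβ _)
      intro i hi k hk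
      rcases (hjmin i hi).eq_or_lt with hi' | hi' <;> rcases (hjmin k hk).eq_or_lt with hk' | hk'
      · rw [hlow i hi'.symm, hlow k hk'.symm, ← hi', ← hk']
        simp
      · rw [hlow i hi'.symm, hhigh k hk', ← hi']
        exact iff_of_true hk' (hlt k)
      · rw [hhigh i hi', hlow k hk'.symm, ← hk']
        exact iff_of_false hi'.not_gt (hlt i).not_gt
      · rw [hhigh i hi', hhigh k hk', hβ.lt_iff_lt, add_lt_add_iff_right]
        exact hbu i (Finset.mem_filter.2 ⟨hi, hi'⟩) k (Finset.mem_filter.2 ⟨hk, hk'⟩)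
  obtain ⟨b, hb, hbu⟩ := main Finset.univ fun _ _ _ _ => Finset.mem_univ _
  exact hR b hb u fun i k => (hbu i (Finset.mem_univ _) k (Finset.mem_univ _)).symm

/-- If `R` contains tuples `s` and `t` such that the `j`-th entry is lexicographically least in
`(s, t)` among the entries with index in `U`, but no tuple of `R` has its `j`-th entry strictly
below its entries with index in `U`, then there is a nonempty part `K` of `U` on which every tuple
of `R` with minimal `j`-th entry is constant, in the sharpest possible way. -/
theorem exists_forced_ties {n : ℕ} {R : Set (Fin n → ℚ)} (hR : OrderInvariant R)
    {f : ℚ → ℚ → ℚ} (hf : IsMi f) (hpres : Preserves f R) {E U : Finset (Fin n)} {j : Fin n}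
    {s t : Fin n → ℚ} (hs : s ∈ R) (ht : t ∈ R) (hsE : ∀ k ∈ E, s k = s j)
    (htE : ∀ k ∈ E, t k = t j) (hle : ∀ k ∈ U, s j ≤ s k)
    (hlex : ∀ k ∈ U, s k = s j → t j < t k)
    (hno : ¬ ∃ a ∈ R, (∀ k ∈ E, a k = a j) ∧ ∀ k ∈ U, a j < a k) :
    ∃ K ⊆ U, K.Nonempty ∧
      (∃ a ∈ R, (∀ k ∈ E, a k = a j) ∧ (∀ k ∈ K, a k = a j) ∧ ∀ k ∈ U \ K, a j < a k) ∧
      (∃ a ∈ R, (∀ k ∈ E, a k = a j) ∧ ∃ q, a j < q ∧ ∀ k ∈ K, a k = q) ∧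
      ∀ a ∈ R, (∀ k ∈ E, a k = a j) → (∀ k ∈ U, a j ≤ a k) → ∀ k ∈ K, a k = a j := by
  obtain ⟨α, β, γ, -, -, hαβ, hβγ, hγα, hfeq, hfgt, hflt⟩ := hf.exists_params
  have hαγ : ∀ x, α x < γ x := fun x => (hαβ x).trans (hβγ x)
  have shift : ∀ a ∈ R, (fun i => a i - a j) ∈ R := fun a ha =>
    hR.comp_strictMono ha (f := fun q => q - a j) fun p q h => by simpa using h
  let good : Set (Fin n → ℚ) := {a | a ∈ R ∧ (∀ k ∈ E, a k = a j) ∧ ∀ k ∈ U, a j ≤ a k}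
  let ties : (Fin n → ℚ) → Finset (Fin n) := fun a => U.filter fun k => a k = a j
  have hgood : good.Nonempty := ⟨s, hs, hsE, hle⟩
  obtain ⟨s₀, ⟨hs₀, hs₀E, hs₀U⟩, hmin⟩ : ∃ a ∈ good, ∀ b ∈ good, (ties a).card ≤ (ties b).card := by
    obtain ⟨a, ha, hamin⟩ := WellFounded.has_min (measure fun a => (ties a).card).wf good hgood
    exact ⟨a, ha, fun b hb => not_lt.1 (hamin b hb)⟩
  have hmemK : ∀ k, k ∈ ties s₀ ↔ k ∈ U ∧ s₀ k = s₀ j := fun k => Finset.mem_filter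
  have hforced : ∀ a ∈ R, (∀ k ∈ E, a k = a j) → (∀ k ∈ U, a j ≤ a k) →
      ∀ k ∈ ties s₀, a k = a j := by
    intro a ha haE haU
    -- On nonnegative arguments `mi` takes its least value `α 0` only at (0, 0), so `c` ties with
    -- `j` on U only where both `s₀` and `a` do. Minimality of `s₀` then leaves no tie to lose.
    let c : Fin n → ℚ := fun i => f (s₀ i - s₀ j) (a i - a j)
    have hcj : c j = α 0 := by simp only [c, sub_self, hfeq]
    have hcU : ∀ k ∈ U, α 0 ≤ c k ∧ (c k = α 0 → s₀ k = s₀ j ∧ a k = a j) := by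
      intro k hk
      have h₁ : 0 ≤ s₀ k - s₀ j := sub_nonneg.2 (hs₀U k hk)
      have h₂ : 0 ≤ a k - a j := sub_nonneg.2 (haU k hk)
      rcases h₁.eq_or_lt with h₁ | h₁ <;> rcases h₂.eq_or_lt with h₂ | h₂
      · have : c k = α 0 := by simp only [c, ← h₁, ← h₂, hfeq]
        exact ⟨this.ge, fun _ => ⟨by linarith, by linarith⟩⟩
      · have : c k = γ 0 := by simp only [c, ← h₁]; exact hflt _ _ h₂
        rw [this]
        exact ⟨(hαγ 0).le, fun h => absurd h (hαγ 0).ne'⟩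
      · have : c k = β 0 := by simp only [c, ← h₂]; exact hfgt _ _ h₁
        rw [this]
        exact ⟨(hαβ 0).le, fun h => absurd h (hαβ 0).ne'⟩
      · have : α 0 < c k := by
          refine ((hαγ 0).trans (hγα 0 _ (lt_min h₁ h₂))).trans_le ?_
          rcases lt_trichotomy (s₀ k - s₀ j) (a k - a j) with h | h | h
          · rw [min_eq_left h.le, show c k = _ from hflt _ _ h]
            exact (hαγ _).le
          · simp only [c, h, min_self, hfeq, le_refl]
          · rw [min_eq_right h.le, show c k = _ from hfgt _ _ h]
            exact (hαβ _).le
        exact ⟨this.le, fun h => absurd h this.ne'⟩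
    have hc : c ∈ good := by
      refine ⟨hpres _ (shift s₀ hs₀) _ (shift a ha), fun k hk => ?_, fun k hk => ?_⟩
      · simp only [c, hs₀E k hk, haE k hk]
      · rw [hcj]
        exact (hcU k hk).1
    have hsub : ties c ⊆ ties s₀ := by
      intro k hk
      obtain ⟨hkU, hk⟩ := Finset.mem_filter.1 hk
      exact (hmemK k).2 ⟨hkU, ((hcU k hkU).2 (hk.trans hcj)).1⟩
    intro k hk
    rw [← Finset.eq_of_subset_of_card_le hsub (hmin c hc)] at hk
    obtain ⟨hkU, hk⟩ := Finset.mem_filter.1 hk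
    exact ((hcU k hkU).2 (hk.trans hcj)).2
  have hstrict : ∀ k ∈ U \ ties s₀, s₀ j < s₀ k := by
    intro k hk
    rw [Finset.mem_sdiff, hmemK] at hk
    exact lt_of_le_of_ne (hs₀U k hk.1) fun h => hk.2 ⟨hk.1, h.symm⟩
  refine ⟨ties s₀, Finset.filter_subset _ _, ?_, ⟨s₀, hs₀, hs₀E, fun k hk => ((hmemK k).1 hk).2,
    hstrict⟩, ?_, hforced⟩
  · rw [Finset.nonempty_iff_ne_empty]
    intro h
    exact hno ⟨s₀, hs₀, hs₀E, fun k hk => hstrict k (by simpa [h] using hk)⟩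
  -- `s` is itself tied on K, so `hlex` puts `t` strictly above `t j` there. As the shifted `s₀` is
  -- 0 on K, `mi` returns the single value `γ 0`.
  · refine ⟨_, hpres _ (shift s₀ hs₀) _ (shift t ht), fun k hk => ?_, γ 0, ?_, fun k hk => ?_⟩
    · simp only [hs₀E k hk, htE k hk]
    · simp only [sub_self, hfeq]
      exact hαγ 0
    · have h₁ := hforced s hs hsE hle k hk
      obtain ⟨hkU, h₂⟩ := (hmemK k).1 hk
      rw [h₂, sub_self]
      exact hflt _ _ (sub_pos.2 (hlex k hkU h₁))

/-! ### The ternary relation cut out by forced ties -/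

/-- The tuple `a` of `R` witnesses `x`, `y`, `z` as its `j`-th entry (shared with `E`), its common
entry on `K`, and a strict lower bound of its entries on `F`. -/
def TieWitness {n : ℕ} (R : Set (Fin n → ℚ)) (E K F : Finset (Fin n)) (j : Fin n)
    (a : Fin n → ℚ) (x y z : ℚ) : Prop :=
  a ∈ R ∧ (∀ k ∈ E, a k = a j) ∧ a j = x ∧ (∀ k ∈ K, a k = y) ∧ ∀ k ∈ F, z < a k

theorem exists_strictMono_interp {ι : Type*} [Finite ι] (c : ι → ℚ) {p q x y z : ℚ} (hpq : p < q)
    (hxy : x < y) (hzx : z < x) :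
    ∃ g : ℚ → ℚ, StrictMono g ∧ g p = x ∧ g q = y ∧ ∀ i, z < g (c i) := by
  obtain ⟨m, hmp, hm⟩ : ∃ m, m < p ∧ ∀ i, m ≤ c i := by
    obtain ⟨m, hm⟩ := (Set.finite_range c).bddBelow
    exact ⟨min m (p - 1), (min_le_right _ _).trans_lt (by linarith),
      fun i => (min_le_left _ _).trans (hm ⟨i, rfl⟩)⟩
  have hA : 0 < (y - x) / (q - p) := div_pos (by linarith) (by linarith)
  -- The slope left of `p`; the extra 1 keeps the image of `m` strictly above `z`.
  have hB : 0 < (x - z) / (p - m + 1) := div_pos (by linarith) (by linarith)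
  have hA' : (q - p) * ((y - x) / (q - p)) = y - x := mul_div_cancel₀ _ (by linarith)
  have hB' : (p - m + 1) * ((x - z) / (p - m + 1)) = x - z := mul_div_cancel₀ _ (by linarith)
  generalize (y - x) / (q - p) = A at *
  generalize (x - z) / (p - m + 1) = B at *
  have hg : StrictMono fun r : ℚ => x + (r - p) * if p ≤ r then A else B := by
    intro r r' h
    dsimp only
    split_ifs <;> nlinarith
  refine ⟨_, hg, by simp, by simp only [if_pos hpq.le]; linarith, fun i => ?_⟩
  refine lt_of_lt_of_le ?_ (hg.monotone (hm i))
  simp only [if_neg hmp.not_ge]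
  nlinarith

theorem OrderInvariant.exists_tieWitness {n : ℕ} {R : Set (Fin n → ℚ)} (hR : OrderInvariant R)
    {E K F : Finset (Fin n)} {j : Fin n} {a : Fin n → ℚ} (ha : a ∈ R) (haE : ∀ k ∈ E, a k = a j)
    {q : ℚ} (hq : ∀ k ∈ K, a k = q) {x y z : ℚ}
    (h : (a j < q ∧ x < y ∧ z < x) ∨ (q < a j ∧ y < x ∧ z < y)) :
    ∃ b, TieWitness R E K F j b x y z := by
  obtain ⟨g, hg, hgj, hgq, hgz⟩ : ∃ g : ℚ → ℚ, StrictMono g ∧ g (a j) = x ∧ g q = y ∧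
      ∀ i, z < g (a i) := by
    rcases h with ⟨h₁, h₂, h₃⟩ | ⟨h₁, h₂, h₃⟩
    · exact exists_strictMono_interp a h₁ h₂ h₃
    · obtain ⟨g, hg, h₄, h₅, h₆⟩ := exists_strictMono_interp a h₁ h₂ h₃
      exact ⟨g, hg, h₅, h₄, h₆⟩
  exact ⟨_, hR.comp_strictMono ha hg, fun k hk => by simp only [haE k hk], hgj,
    fun k hk => by simp only [hq k hk, hgq], fun k _ => hgz k⟩

/-- No relation between `x` and `z` is needed: the entries on `F` lie above the `j`-th one and can
be pushed past `z`. -/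
theorem OrderInvariant.exists_tieWitness_self {n : ℕ} {R : Set (Fin n → ℚ)}
    (hR : OrderInvariant R) {E K F : Finset (Fin n)} {j : Fin n} {a : Fin n → ℚ} (ha : a ∈ R)
    (haE : ∀ k ∈ E, a k = a j) (haK : ∀ k ∈ K, a k = a j) (haF : ∀ k ∈ F, a j < a k) (x z : ℚ) :
    ∃ b, TieWitness R E K F j b x x z := by
  have hC : z ≤ x + |z - x| := by linarith [le_abs_self (z - x)]
  have hC₀ := abs_nonneg (z - x)
  have hg : StrictMono fun q : ℚ => q - a j + x + if a j < q then |z - x| else 0 := by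
    intro p q hpq
    dsimp only
    split_ifs <;> linarith
  refine ⟨_, hR.comp_strictMono ha hg, fun k hk => by simp only [haE k hk], by simp,
    fun k hk => by simp [haK k hk], fun k hk => ?_⟩
  have := haF k hk
  simp only [if_pos this]
  linarith

theorem ConjDefinable.tieWitness {L : FirstOrder.Language} [L.Structure ℚ] {n : ℕ}
    (r : L.Relations n) {lt : L.Relations 2}
    (hlt : ∀ a : Fin 2 → ℚ, Structure.RelMap lt a ↔ a 0 < a 1) (E K F : Finset (Fin n))
    (j : Fin n) {γ : Type*} (f : Fin n → γ) (x y z : γ) :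
    ConjDefinable L {v : γ → ℚ |
      TieWitness {a | Structure.RelMap r a} E K F j (fun i => v (f i)) (v x) (v y) (v z)} := by
  have : Nonempty γ := ⟨x⟩
  have hltD : ∀ k, ConjDefinable L {v : γ → ℚ | v z < v (f k)} := fun k => by
    have := ConjDefinable.rel (M := ℚ) lt ![z, f k]
    simpa [hlt] using this
  exact (ConjDefinable.rel r f).and <|
    (ConjDefinable.forall_mem E fun k _ => .eq (f k) (f j)).and <|
    (ConjDefinable.eq (f j) x).and <|
    (ConjDefinable.forall_mem K fun k _ => .eq (f k) y).and <|
    ConjDefinable.forall_mem F fun k _ => hltD k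

theorem ppDefinable_Rmix_of_local_obstruction {L : FirstOrder.Language} [L.Structure ℚ] {n : ℕ}
    {r : L.Relations n} {lt : L.Relations 2}
    (hlt : ∀ a : Fin 2 → ℚ, Structure.RelMap lt a ↔ a 0 < a 1)
    (hR : OrderInvariant {a : Fin n → ℚ | Structure.RelMap r a}) {f : ℚ → ℚ → ℚ} (hf : IsMi f)
    (hpres : Preserves f {a : Fin n → ℚ | Structure.RelMap r a}) {E U : Finset (Fin n)} {j : Fin n}
    {s t : Fin n → ℚ} (hs : Structure.RelMap r s) (ht : Structure.RelMap r t)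
    (hsE : ∀ k ∈ E, s k = s j) (htE : ∀ k ∈ E, t k = t j) (hle : ∀ k ∈ U, s j ≤ s k)
    (hlex : ∀ k ∈ U, s k = s j → t j < t k)
    (hno : ¬ ∃ a : Fin n → ℚ, Structure.RelMap r a ∧ (∀ k ∈ E, a k = a j) ∧ ∀ k ∈ U, a j < a k) :
    PPDefinable L Rmix := by
  obtain ⟨K, hKU, ⟨k₀, hk₀⟩, ⟨a₀, ha₀, ha₀E, ha₀K, ha₀F⟩, ⟨a₁, ha₁, ha₁E, q, hq, ha₁K⟩, hforced⟩ :=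
    exists_forced_ties hR hf hpres hs ht hsE htE hle hlex hno
  let P : (Fin n → ℚ) → ℚ → ℚ → ℚ → Prop :=
    TieWitness {a : Fin n → ℚ | Structure.RelMap r a} E K (U \ K) j
  have hdiag : ∀ x z, ∃ a, P a x x z := hR.exists_tieWitness_self ha₀ ha₀E ha₀K ha₀F
  have hup : ∀ {x y z}, x < y → z < x → ∃ a, P a x y z := fun h₁ h₂ =>
    hR.exists_tieWitness ha₁ ha₁E ha₁K (.inl ⟨hq, h₁, h₂⟩)
  have hsound : ∀ {a x y z}, P a x y z → x < y → z < x := by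
    rintro a x y z ⟨ha, haE, rfl, haK, haF⟩ hxy
    by_contra hzx
    refine hxy.ne ?_
    rw [← haK k₀ hk₀]
    refine (hforced a ha haE (fun k hk => ?_) k₀ hk₀).symm
    by_cases hkK : k ∈ K
    · rw [haK k hkK]
      exact hxy.le
    · exact (not_lt.1 hzx).trans (haF k (Finset.mem_sdiff.2 ⟨hk, hkK⟩)).le
  let e₁ : Fin n → Fin 3 ⊕ (Fin n ⊕ Fin n) := fun i => .inr (.inl i)
  let e₂ : Fin n → Fin 3 ⊕ (Fin n ⊕ Fin n) := fun i => .inr (.inr i)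
  by_cases hdown : ∃ a x y z, P a x y z ∧ y < x
  -- If y < x can occur, the relation also contains z < y < x, so its conjunction with the copy
  -- swapping x and y is `Rmix`.
  · obtain ⟨a₂, x₂, y₂, z₂, ⟨ha₂, ha₂E, rfl, ha₂K, -⟩, hyx⟩ := hdown
    have hdn : ∀ {x y z}, y < x → z < y → ∃ a, P a x y z := fun h₁ h₂ =>
      hR.exists_tieWitness ha₂ ha₂E ha₂K (.inr ⟨hyx, h₁, h₂⟩)
    have hpp := ((ConjDefinable.tieWitness r hlt E K (U \ K) j e₁ (.inl 0) (.inl 1) (.inl 2)).and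
      (ConjDefinable.tieWitness r hlt E K (U \ K) j e₂ (.inl 1) (.inl 0)
        (.inl 2))).ppDefinable_exists
    convert hpp using 1
    ext v
    change _ ↔ ∃ b : Fin n ⊕ Fin n → ℚ, P (fun i => b (.inl i)) (v 0) (v 1) (v 2) ∧
      P (fun i => b (.inr i)) (v 1) (v 0) (v 2)
    constructor
    · intro hv
      obtain ⟨⟨a, ha⟩, ⟨b, hb⟩⟩ : (∃ a, P a (v 0) (v 1) (v 2)) ∧ ∃ b, P b (v 1) (v 0) (v 2) := by
        rcases hv with hv | ⟨h₁, h₂⟩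
        · rw [hv]
          exact ⟨hdiag _ _, hdiag _ _⟩
        · rcases lt_trichotomy (v 0) (v 1) with h | h | h
          · exact ⟨hup h h₁, hdn h h₁⟩
          · rw [h]
            exact ⟨hdiag _ _, hdiag _ _⟩
          · exact ⟨hdn h h₂, hup h h₂⟩
      exact ⟨Sum.elim a b, ha, hb⟩
    · rintro ⟨b, h₁, h₂⟩
      rcases lt_trichotomy (v 0) (v 1) with h | h | h
      · exact .inr ⟨hsound h₁ h, (hsound h₁ h).trans h⟩
      · exact .inl h
      · exact .inr ⟨(hsound h₂ h).trans h, hsound h₂ h⟩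
  · push Not at hdown
    -- Otherwise x ≤ y always, and `Rmix` is obtained by giving both arguments a common upper
    -- partner w. The entry at `k₀` of the first witness serves as w.
    have hpp := ((ConjDefinable.tieWitness r hlt E K (U \ K) j e₁ (.inl 0) (e₁ k₀) (.inl 2)).and
      (ConjDefinable.tieWitness r hlt E K (U \ K) j e₂ (.inl 1) (e₁ k₀)
        (.inl 2))).ppDefinable_exists
    convert hpp using 1
    ext v
    change _ ↔ ∃ b : Fin n ⊕ Fin n → ℚ,
      P (fun i => b (.inl i)) (v 0) (b (.inl k₀)) (v 2) ∧
      P (fun i => b (.inr i)) (v 1) (b (.inl k₀)) (v 2)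
    constructor
    · intro hv
      obtain ⟨w, ⟨a, ha⟩, ⟨b, hb⟩⟩ :
          ∃ w, (∃ a, P a (v 0) w (v 2)) ∧ ∃ b, P b (v 1) w (v 2) := by
        rcases hv with hv | ⟨h₁, h₂⟩
        · rw [hv]
          exact ⟨v 1, hdiag _ _, hdiag _ _⟩
        · have h₃ := le_max_left (v 0) (v 1)
          have h₄ := le_max_right (v 0) (v 1)
          exact ⟨max (v 0) (v 1) + 1, hup (by linarith) h₁, hup (by linarith) h₂⟩
      have haw : a k₀ = w := ha.2.2.2.1 k₀ hk₀
      refine ⟨Sum.elim a b, ?_⟩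
      simp only [Sum.elim_inl, Sum.elim_inr, haw]
      exact ⟨ha, hb⟩
    · rintro ⟨b, h₁, h₂⟩
      rcases (hdown _ _ _ _ h₁).eq_or_lt with h₃ | h₃ <;>
        rcases (hdown _ _ _ _ h₂).eq_or_lt with h₄ | h₄
      · exact .inl (h₃.trans h₄.symm)
      · exact .inr ⟨h₃ ▸ (hsound h₂ h₄).trans h₄, hsound h₂ h₄⟩
      · exact .inr ⟨hsound h₁ h₃, h₄ ▸ (hsound h₁ h₃).trans h₃⟩
      · exact .inr ⟨hsound h₁ h₃, hsound h₂ h₄⟩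

/-! ### The operation `ll` -/

/-- Injectivity of `ll` makes both `s` and `t` constant on the ties of `ll(s, t)`. -/
theorem IsLl.eq_and_eq {f : ℚ → ℚ → ℚ} (hf : IsLl f) {a b a' b' : ℚ} (h : f a b = f a' b') :
    a = a' ∧ b = b' := by
  have h₁ := (hf a b a' b').not.1 h.not_lt
  have h₂ := (hf a' b' a b).not.1 h.not_gt
  push Not at h₁ h₂
  grind

end TemporalCSP

open TemporalCSP FirstOrder FirstOrder.Language in
theorem proposition5p6 (L : FirstOrder.Language) [L.IsRelational] [L.Structure ℚ]
    (hA : TemporalCSP.IsFirstOrderExpansionOfRatLt L)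
    (mi : ℚ → ℚ → ℚ) (hmi : TemporalCSP.IsMi mi)
    (ll : ℚ → ℚ → ℚ) (hll : TemporalCSP.IsLl ll)
    (hpres : TemporalCSP.IsPreservedBy L mi)
    (hnpres : ¬ TemporalCSP.IsPreservedBy L ll) :
    TemporalCSP.PPDefinable L TemporalCSP.Rmix := by
  obtain ⟨⟨lt, hlt⟩, hdef⟩ := hA
  simp only [IsPreservedBy, Preserves] at hnpres
  push Not at hnpres
  obtain ⟨n, r, s, hs, t, ht, hst⟩ := hnpres
  have hR := OrderInvariant.of_definable (hdef n r)
  have hloc := mt (mem_of_local_tuples hR hmi (hpres n r) ⟨s, hs⟩) hst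
  push Not at hloc
  obtain ⟨j, hj⟩ := hloc
  let E : Finset (Fin n) := Finset.univ.filter fun k => ll (s k) (t k) = ll (s j) (t j)
  let U : Finset (Fin n) := Finset.univ.filter fun k => ll (s j) (t j) < ll (s k) (t k)
  have hE : ∀ k ∈ E, s k = s j ∧ t k = t j := fun k hk =>
    hll.eq_and_eq (Finset.mem_filter.1 hk).2
  have hU : ∀ k ∈ U, _ := fun k hk => (hll _ _ _ _).1 (Finset.mem_filter.1 hk).2
  have hno : ¬ ∃ a : Fin n → ℚ, Structure.RelMap r a ∧ (∀ k ∈ E, a k = a j) ∧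
      ∀ k ∈ U, a j < a k := by
    rintro ⟨a, ha, haE, haU⟩
    obtain ⟨k, hk, hak⟩ := hj a ha fun k hk => haE k (Finset.mem_filter.2 ⟨Finset.mem_univ _, hk⟩)
    exact hak.not_gt (haU k (Finset.mem_filter.2 ⟨Finset.mem_univ _, hk⟩))
  -- Above a pair with first entry ≤ 0, `ll` is lexicographic with `s` leading; otherwise `t` leads
  -- and the two tuples swap roles.
  rcases le_or_gt (s j) 0 with h0 | h0
  · refine ppDefinable_Rmix_of_local_obstruction hlt hR hmi (hpres n r) hs ht
      (fun k hk => (hE k hk).1) (fun k hk => (hE k hk).2) (fun k hk => ?_) (fun k hk => ?_) hno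
    · have := hU k hk
      grind
    · have := hU k hk
      grind
  · refine ppDefinable_Rmix_of_local_obstruction hlt hR hmi (hpres n r) ht hs
      (fun k hk => (hE k hk).2) (fun k hk => (hE k hk).1) (fun k hk => ?_) (fun k hk => ?_) hno
    · have := hU k hk
      grind
    · have := hU k hk
      grind
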